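/- Let $\mathbb K$ be $\mathbb R$ or $\mathbb C$; all Banach spaces are over $\mathbb K$ and operators are continuous and linear. For a Banach space $E$ let $\varphi_E : E \to E''$ be the canonical map into the bidual, let $\hat E = (E \times E'' \times E'')_2$ be the $\ell^2$-direct sum, with norm $\|(x,x'',y'')\| = (\|x\|^2 + \|x''\|^2 + \|y''\|^2)^{1/2}$, and define operators $i_E, j_E : E \to \hat E$ by $i_E(x) = (x, \varphi_E(x), 0)$ and $j_E(x) = (x, 0, \varphi_E(x))$. Two operators $u, v : E \to F$ between Banach spaces are called homotopic if there exists an operator $h : \hat E \to F$ with $h i_E = u$ and $h j_E = v$. An operator is called weakly compact if it maps the closed unit ball to a relatively weakly compact set. Proposition. Let $F$ be a separable Banach space and let $u, v : c_0 \to F$ be operators. Then $u$ and $v$ are homotopic if and only if $u - v$ is weakly compact. -/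

import Mathlib

set_option maxSynthPendingDepth 3

open scoped ZeroAtInfty

/-- The bidual `E''` of a normed space over `𝕜`. -/
abbrev Bidual (𝕜 : Type*) [RCLike 𝕜] (E : Type*) [NormedAddCommGroup E] [NormedSpace 𝕜 E] :
    Type _ :=
  StrongDual 𝕜 (StrongDual 𝕜 E)

/-- The Banach space `Ê = (E × E'' × E'')₂`, the `ℓ²`-direct sum of the three factors. (The
`ℓ²`-sum is associative, so nesting two binary sums gives the norm
`√(‖x‖² + ‖x''‖² + ‖y''‖²)`.) -/
abbrev Hat (𝕜 : Type*) [RCLike 𝕜] (E : Type*) [NormedAddCommGroup E] [NormedSpace 𝕜 E] :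
    Type _ :=
  WithLp 2 (E × WithLp 2 (Bidual 𝕜 E × Bidual 𝕜 E))

/-- The operator `(x, x'', y'') ↦ (x, x'', y'')` from the product space to `Ê`. -/
noncomputable def toHat (𝕜 : Type*) [RCLike 𝕜] (E : Type*) [NormedAddCommGroup E]
    [NormedSpace 𝕜 E] : (E × (Bidual 𝕜 E × Bidual 𝕜 E)) →L[𝕜] Hat 𝕜 E :=
  ((WithLp.prodContinuousLinearEquiv 2 𝕜 E
      (WithLp 2 (Bidual 𝕜 E × Bidual 𝕜 E))).symm.toContinuousLinearMap).comp
    ((ContinuousLinearMap.id 𝕜 E).prodMap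
      (WithLp.prodContinuousLinearEquiv 2 𝕜 (Bidual 𝕜 E)
        (Bidual 𝕜 E)).symm.toContinuousLinearMap)

/-- `i_E x = (x, φ_E x, 0)`, where `φ_E : E → E''` is the canonical map. -/
noncomputable def hatI (𝕜 : Type*) [RCLike 𝕜] (E : Type*) [NormedAddCommGroup E]
    [NormedSpace 𝕜 E] : E →L[𝕜] Hat 𝕜 E :=
  (toHat 𝕜 E).comp
    ((ContinuousLinearMap.id 𝕜 E).prod ((NormedSpace.inclusionInDoubleDual 𝕜 E).prod 0))

/-- `j_E x = (x, 0, φ_E x)`, where `φ_E : E → E''` is the canonical map. -/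
noncomputable def hatJ (𝕜 : Type*) [RCLike 𝕜] (E : Type*) [NormedAddCommGroup E]
    [NormedSpace 𝕜 E] : E →L[𝕜] Hat 𝕜 E :=
  (toHat 𝕜 E).comp
    ((ContinuousLinearMap.id 𝕜 E).prod
      (ContinuousLinearMap.prod 0 (NormedSpace.inclusionInDoubleDual 𝕜 E)))

/-- Operators `u, v : E → F` are homotopic if there is an operator `h : Ê → F` with
`h i_E = u` and `h j_E = v`. -/
def OperatorHomotopic {𝕜 : Type*} [RCLike 𝕜] {E F : Type*}
    [NormedAddCommGroup E] [NormedSpace 𝕜 E] [NormedAddCommGroup F] [NormedSpace 𝕜 F]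
    (u v : E →L[𝕜] F) : Prop :=
  ∃ h : Hat 𝕜 E →L[𝕜] F, h.comp (hatI 𝕜 E) = u ∧ h.comp (hatJ 𝕜 E) = v

/-- A bounded operator is weakly compact if the image of the closed unit ball is relatively
compact for the weak topology of the codomain. -/
def IsWeaklyCompactOperator {𝕜 : Type*} [RCLike 𝕜] {E F : Type*}
    [NormedAddCommGroup E] [NormedSpace 𝕜 E] [NormedAddCommGroup F] [NormedSpace 𝕜 F]
    (u : E →L[𝕜] F) : Prop :=
  IsCompact (closure (toWeakSpace 𝕜 F '' (u '' Metric.closedBall (0 : E) 1)))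

/-! Since `h i_E - h j_E` is `h` evaluated on `(0, φ_E x, -φ_E x)`, homotopy forces `u - v` to
extend along `φ_E` to the bidual; conversely an extension `w` gives the homotopy `(x, x'', y'') ↦ v
x + w x''`. It remains to see that `T : c₀ → F` extends to the bidual iff it is weakly compact. If
`T` is weakly compact, its second adjoint takes values in `F`
(`IsWeaklyCompactOperator.exists_bidual_apply_comp_eq`). If `T` extends, it is even compact, being
the norm limit of its compositions with coordinate projections (`tendsto_comp_coordinateProj`).
Otherwise disjointly supported `bₖ` in the unit ball have `‖T bₖ‖ > ε`. They span an operator from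
`ℓ∞` to the bidual, hence one into `F` that is large on every unit vector. Rosenthal's lemma then
makes the images of indicators of subsets of some infinite set uniformly separated, contradicting
separability. -/

open Filter Topology

/-! ### Rosenthal's disjointness lemma -/

section RosenthalLemma

/-- Rosenthal's disjointness lemma for a sequence of uniformly bounded, monotone, superadditive
set functions on `ℕ`. -/
theorem exists_infinite_diff_singleton_le {V : ℕ → Set ℕ → ℝ}
    (mono : ∀ k A B, A ⊆ B → V k A ≤ V k B)
    (super : ∀ k A B, Disjoint A B → V k A + V k B ≤ V k (A ∪ B))
    {C : ℝ} (bdd : ∀ k A, V k A ≤ C) {ε : ℝ} (hε : 0 < ε) :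
    ∃ M : Set ℕ, M.Infinite ∧ ∀ k ∈ M, V k (M \ {k}) ≤ ε := by
  have key : ∀ (n : ℕ) (M : Set ℕ), M.Infinite → (∀ k ∈ M, V k M ≤ n * ε) →
      ∃ M' : Set ℕ, M'.Infinite ∧ ∀ k ∈ M', V k (M' \ {k}) ≤ ε := by
    intro n
    induction n with
    | zero =>
      intro M hM h
      refine ⟨M, hM, fun k hk => (mono k _ _ Set.sdiff_subset).trans ((h k hk).trans ?_)⟩
      simpa using hε.le
    | succ n ih =>
      intro M hM h
      -- Split `M` into infinitely many infinite pieces `P p`. If every piece fails at some `k p`,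
      -- the set of these `k p` misses `P p \ {k p}`, so superadditivity lowers the bound on it by
      -- `ε`.
      have := hM.to_subtype
      obtain ⟨e⟩ : Nonempty (ℕ × ℕ ≃ M) := nonempty_equiv_of_countable
      have einj : ∀ a b, (e a : ℕ) = e b → a = b := fun a b hab =>
        e.injective (Subtype.ext hab)
      let P : ℕ → Set ℕ := fun p => Set.range fun q => (e (p, q) : ℕ)
      have hPinf : ∀ p, (P p).Infinite := fun p =>
        Set.infinite_range_of_injective fun a b hab => (Prod.ext_iff.1 (einj _ _ hab)).2
      have hPM : ∀ p, P p ⊆ M := by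
        rintro p _ ⟨q, rfl⟩
        exact (e (p, q)).2
      by_cases hgood : ∃ p, ∀ k ∈ P p, V k (P p \ {k}) ≤ ε
      · obtain ⟨p, hp⟩ := hgood
        exact ⟨P p, hPinf p, hp⟩
      push Not at hgood
      choose k hkP hk using hgood
      choose q hq using hkP
      have hkinj : ∀ p p' q', k p = e (p', q') → p = p' := fun p p' q' hpp =>
        (Prod.ext_iff.1 (einj _ _ ((hq p).trans hpp))).1
      have hkM : Set.range k ⊆ M := by
        rintro _ ⟨p, rfl⟩
        rw [← hq p]
        exact (e _).2
      refine ih (Set.range k)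
        (Set.infinite_range_of_injective fun p p' hpp => hkinj p p' (q p') (hpp.trans (hq p').symm))
        ?_
      rintro _ ⟨p, rfl⟩
      have hdisj : Disjoint (Set.range k) (P p \ {k p}) := by
        rw [Set.disjoint_left]
        rintro _ ⟨p', rfl⟩ ⟨⟨q', hq'⟩, hne⟩
        exact hne (by rw [hkinj p' p q' hq'.symm]; rfl)
      have h1 := super (k p) _ _ hdisj
      have h2 := mono (k p) _ _ (Set.union_subset hkM ((Set.sdiff_subset (t := {k p})).trans (hPM p)))
      have h3 := h (k p) (hkM ⟨p, rfl⟩)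
      have h4 := hk p
      push_cast at h3
      linarith
  obtain ⟨n, hn⟩ := exists_nat_ge (C / ε)
  exact key n Set.univ Set.infinite_univ fun k _ =>
    (bdd k _).trans ((div_le_iff₀ hε).1 hn)

end RosenthalLemma

/-! ### Variation of functionals on `ℓ∞` -/

section Variation

variable {𝕜 : Type*} [RCLike 𝕜]

open BoundedContinuousFunction

/-- The total variation on `A` of the finitely additive measure on `ℕ` represented by a functional
on `ℓ∞`. -/
noncomputable def functionalVariation (μ : StrongDual 𝕜 (ℕ →ᵇ 𝕜)) (A : Set ℕ) : ℝ :=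
  ⨆ c : {c : ℕ →ᵇ 𝕜 // ‖c‖ ≤ 1 ∧ ∀ n ∉ A, c n = 0}, ‖μ c‖

instance (A : Set ℕ) : Nonempty {c : ℕ →ᵇ 𝕜 // ‖c‖ ≤ 1 ∧ ∀ n ∉ A, c n = 0} :=
  ⟨⟨0, by simp⟩⟩

theorem le_functionalVariation (μ : StrongDual 𝕜 (ℕ →ᵇ 𝕜)) {A : Set ℕ} {c : ℕ →ᵇ 𝕜}
    (hc : ‖c‖ ≤ 1) (hA : ∀ n ∉ A, c n = 0) : ‖μ c‖ ≤ functionalVariation μ A := by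
  refine le_ciSup (f := fun c : {c : ℕ →ᵇ 𝕜 // ‖c‖ ≤ 1 ∧ ∀ n ∉ A, c n = 0} => ‖μ c‖) ?_
    ⟨c, hc, hA⟩
  refine ⟨‖μ‖, ?_⟩
  rintro _ ⟨d, rfl⟩
  exact μ.unit_le_opNorm _ d.2.1

theorem functionalVariation_le {μ : StrongDual 𝕜 (ℕ →ᵇ 𝕜)} {A : Set ℕ} {C : ℝ}
    (h : ∀ c : ℕ →ᵇ 𝕜, ‖c‖ ≤ 1 → (∀ n ∉ A, c n = 0) → ‖μ c‖ ≤ C) :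
    functionalVariation μ A ≤ C :=
  ciSup_le fun c => h c c.2.1 c.2.2

theorem functionalVariation_le_norm (μ : StrongDual 𝕜 (ℕ →ᵇ 𝕜)) (A : Set ℕ) :
    functionalVariation μ A ≤ ‖μ‖ :=
  functionalVariation_le fun c hc _ => μ.unit_le_opNorm c hc

theorem functionalVariation_mono (μ : StrongDual 𝕜 (ℕ →ᵇ 𝕜)) {A B : Set ℕ} (h : A ⊆ B) :
    functionalVariation μ A ≤ functionalVariation μ B :=
  functionalVariation_le fun _ hc hA =>
    le_functionalVariation μ hc fun n hn => hA n fun hnA => hn (h hnA)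

theorem functionalVariation_add_le (μ : StrongDual 𝕜 (ℕ →ᵇ 𝕜)) {A B : Set ℕ}
    (h : Disjoint A B) :
    functionalVariation μ A + functionalVariation μ B ≤ functionalVariation μ (A ∪ B) := by
  rw [← le_sub_iff_add_le]
  refine functionalVariation_le fun c hc hcA => ?_
  rw [le_sub_comm]
  refine functionalVariation_le fun d hd hdB => ?_
  rw [le_sub_iff_add_le']
  -- Unimodular factors align the two values; disjoint supports keep the sum in the unit ball.
  obtain ⟨α, hα, hαc⟩ := RCLike.exists_norm_eq_mul_self (μ c)
  obtain ⟨β, hβ, hβd⟩ := RCLike.exists_norm_eq_mul_self (μ d)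
  have hsum : ‖μ (α • c + β • d)‖ = ‖μ c‖ + ‖μ d‖ := by
    rw [map_add, map_smul, map_smul, smul_eq_mul, smul_eq_mul, ← hαc, ← hβd, ← RCLike.ofReal_add,
      RCLike.norm_ofReal, abs_of_nonneg (by positivity)]
  rw [← hsum]
  have hcn : ∀ n, ‖c n‖ ≤ 1 := fun n => (c.norm_coe_le_norm n).trans hc
  have hdn : ∀ n, ‖d n‖ ≤ 1 := fun n => (d.norm_coe_le_norm n).trans hd
  refine le_functionalVariation μ ?_ ?_
  · rw [BoundedContinuousFunction.norm_le zero_le_one]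
    intro n
    by_cases hn : n ∈ A
    · simpa [hdB n (Set.disjoint_left.1 h hn), hα] using hcn n
    · simpa [hcA n hn, hβ] using hdn n
  · intro n hn
    rw [Set.mem_union, not_or] at hn
    simp [hcA n hn.1, hdB n hn.2]

end Variation

/-! ### Operators from `ℓ∞` to separable spaces -/

section Operators

variable {𝕜 : Type*} [RCLike 𝕜] {F : Type*} [NormedAddCommGroup F] [NormedSpace 𝕜 F]

open BoundedContinuousFunction

/-- The indicator function of `A` as an element of `ℓ∞`. -/
noncomputable def boundedIndicator (𝕜 : Type*) [RCLike 𝕜] (A : Set ℕ) : ℕ →ᵇ 𝕜 :=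
  BoundedContinuousFunction.ofNormedAddCommGroupDiscrete (A.indicator fun _ => (1 : 𝕜)) 1
    fun n => by by_cases h : n ∈ A <;> simp [h]

theorem boundedIndicator_apply (A : Set ℕ) (n : ℕ) :
    boundedIndicator 𝕜 A n = A.indicator (fun _ => (1 : 𝕜)) n := rfl

theorem norm_boundedIndicator_le (A : Set ℕ) : ‖boundedIndicator 𝕜 A‖ ≤ 1 :=
  (BoundedContinuousFunction.norm_le zero_le_one).2 fun n => by
    rw [boundedIndicator_apply]
    by_cases h : n ∈ A <;> simp [h]

theorem boundedIndicator_eq_add_diff_singleton {A : Set ℕ} {k : ℕ} (hk : k ∈ A) :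
    boundedIndicator 𝕜 A = boundedIndicator 𝕜 {k} + boundedIndicator 𝕜 (A \ {k}) := by
  ext n
  simp only [boundedIndicator_apply, BoundedContinuousFunction.coe_add, Pi.add_apply]
  by_cases h : n = k
  · simp [h, hk]
  · by_cases hn : n ∈ A <;> simp [h, hn]

/-- An operator from `ℓ∞` to a separable space cannot be bounded below on all unit vectors. -/
theorem exists_norm_boundedIndicator_singleton_lt [TopologicalSpace.SeparableSpace F]
    (w : (ℕ →ᵇ 𝕜) →L[𝕜] F) {ε : ℝ} (hε : 0 < ε) :
    ∃ k, ‖w (boundedIndicator 𝕜 {k})‖ < ε := by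
  by_contra! hw
  choose f hf1 hf using fun k => exists_dual_vector'' 𝕜 (w (boundedIndicator 𝕜 {k}))
  let μ : ℕ → StrongDual 𝕜 (ℕ →ᵇ 𝕜) := fun k => (f k).comp w
  have hμ : ∀ k, ‖μ k‖ ≤ ‖w‖ := fun k =>
    ((f k).opNorm_comp_le w).trans (mul_le_of_le_one_left (norm_nonneg w) (hf1 k))
  obtain ⟨M, hM, hMV⟩ := exists_infinite_diff_singleton_le
    (V := fun k => functionalVariation (μ k)) (fun k _ _ => functionalVariation_mono _)
    (fun k _ _ => functionalVariation_add_le _)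
    (fun k A => (functionalVariation_le_norm _ A).trans (hμ k)) (ε := ε / 3) (by positivity)
  have hsmall : ∀ k ∈ M, ∀ A ⊆ M \ {k}, ‖f k (w (boundedIndicator 𝕜 A))‖ ≤ ε / 3 :=
    fun k hk A hA => (le_functionalVariation (μ k) (A := M \ {k}) (norm_boundedIndicator_le A)
      fun n hn => by
        rw [boundedIndicator_apply, Set.indicator_of_notMem fun h => hn (hA h)]).trans (hMV k hk)
  -- Testing with `f k` isolates the `k`-th unit vector, worth at least `ε`, up to two errors of at
  -- most `ε / 3`.
  have hsep : ∀ A B : Set ℕ, A ⊆ M → B ⊆ M → ∀ k ∈ A, k ∉ B →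
      ε / 3 ≤ dist (w (boundedIndicator 𝕜 A)) (w (boundedIndicator 𝕜 B)) := by
    intro A B hA hB k hkA hkB
    have hA' := hsmall k (hA hkA) (A \ {k}) (Set.sdiff_subset_sdiff_left hA)
    have hB' := hsmall k (hA hkA) B fun n hn => ⟨hB hn, fun h => hkB (h ▸ hn)⟩
    have h1 : ‖f k (w (boundedIndicator 𝕜 {k}))‖ = ‖w (boundedIndicator 𝕜 {k})‖ := by
      rw [hf]; simp
    have h2 : f k (w (boundedIndicator 𝕜 {k})) =
        f k (w (boundedIndicator 𝕜 A) - w (boundedIndicator 𝕜 B)) -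
          f k (w (boundedIndicator 𝕜 (A \ {k}))) + f k (w (boundedIndicator 𝕜 B)) := by
      rw [boundedIndicator_eq_add_diff_singleton hkA]
      simp only [map_add, map_sub]
      ring
    have h3 : ‖f k (w (boundedIndicator 𝕜 A) - w (boundedIndicator 𝕜 B))‖ ≤
        dist (w (boundedIndicator 𝕜 A)) (w (boundedIndicator 𝕜 B)) := by
      rw [dist_eq_norm]
      exact ((f k).le_opNorm _).trans (mul_le_of_le_one_left (norm_nonneg _) (hf1 k))
    have h4 := norm_add_le (f k (w (boundedIndicator 𝕜 A) - w (boundedIndicator 𝕜 B)) -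
          f k (w (boundedIndicator 𝕜 (A \ {k})))) (f k (w (boundedIndicator 𝕜 B)))
    have h5 := norm_sub_le (f k (w (boundedIndicator 𝕜 A) - w (boundedIndicator 𝕜 B)))
      (f k (w (boundedIndicator 𝕜 (A \ {k}))))
    rw [← h2, h1] at h4
    linarith [hw k]
  have hdist : ∀ A B : Set ℕ, A ⊆ M → B ⊆ M → A ≠ B →
      ε / 3 ≤ dist (w (boundedIndicator 𝕜 A)) (w (boundedIndicator 𝕜 B)) := by
    intro A B hA hB hAB
    by_cases h : A ⊆ B
    · obtain ⟨k, hkB, hkA⟩ := Set.not_subset.1 fun h' => hAB (h.antisymm h')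
      rw [dist_comm]
      exact hsep B A hB hA k hkB hkA
    · obtain ⟨k, hkA, hkB⟩ := Set.not_subset.1 h
      exact hsep A B hA hB k hkA hkB
  have hcount : (𝒫 M).Countable := by
    refine Set.PairwiseDisjoint.countable_of_isOpen
      (s := fun A => Metric.ball (w (boundedIndicator 𝕜 A)) (ε / 6)) ?_
      (fun _ _ => Metric.isOpen_ball) (fun A _ => ⟨_, Metric.mem_ball_self (by positivity)⟩)
    intro A hA B hB hAB
    exact Metric.ball_disjoint_ball (by linarith [hdist A B hA hB hAB])
  have := hM.to_subtype
  have : Countable (Set M) := by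
    have := hcount.to_subtype
    exact (Equiv.Set.powerset M).symm.injective.countable
  obtain ⟨g, hg⟩ := exists_injective_nat (Set M)
  exact Function.cantor_injective _ ((Infinite.natEmbedding M).injective.comp hg)

end Operators

/-! ### From bounded sums to operators into the bidual -/

section WeaklyUnconditionallyCauchy

variable {𝕜 : Type*} [RCLike 𝕜] {E : Type*} [NormedAddCommGroup E] [NormedSpace 𝕜 E]

open BoundedContinuousFunction

/-- Unimodular coefficients make every term `c n * ψ (b n)` equal to its absolute value. -/
theorem sum_norm_apply_le_of_norm_sum_le {b : ℕ → E}
    (hb : ∀ (s : Finset ℕ) (c : ℕ → 𝕜), (∀ n, ‖c n‖ ≤ 1) → ‖∑ n ∈ s, c n • b n‖ ≤ 1)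
    (ψ : StrongDual 𝕜 E) (s : Finset ℕ) : ∑ n ∈ s, ‖ψ (b n)‖ ≤ ‖ψ‖ := by
  choose c hc1 hc using fun n => RCLike.exists_norm_eq_mul_self (ψ (b n))
  have h : ψ (∑ n ∈ s, c n • b n) = ((∑ n ∈ s, ‖ψ (b n)‖ : ℝ) : 𝕜) := by
    simp [map_sum, ← hc]
  have h' := ψ.unit_le_opNorm _ (hb s c fun n => (hc1 n).le)
  rwa [h, RCLike.norm_ofReal, abs_of_nonneg (by positivity)] at h'

/-- If the finite sums `∑ cₙ bₙ` with `|cₙ| ≤ 1` lie in the unit ball of `E`, then `c ↦ ∑ cₙ bₙ`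
defines an operator from `ℓ∞` to the bidual of `E`. -/
theorem exists_operator_bidual {b : ℕ → E}
    (hb : ∀ (s : Finset ℕ) (c : ℕ → 𝕜), (∀ n, ‖c n‖ ≤ 1) → ‖∑ n ∈ s, c n • b n‖ ≤ 1) :
    ∃ J : (ℕ →ᵇ 𝕜) →L[𝕜] Bidual 𝕜 E, ∀ k,
      J (boundedIndicator 𝕜 {k}) = NormedSpace.inclusionInDoubleDual 𝕜 E (b k) := by
  have hbd := sum_norm_apply_le_of_norm_sum_le hb
  have hsumm : ∀ ψ : StrongDual 𝕜 E, Summable fun n => ‖ψ (b n)‖ := fun ψ =>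
    summable_of_sum_le (fun _ => norm_nonneg _) (hbd ψ)
  have hle : ∀ (c : ℕ →ᵇ 𝕜) (ψ : StrongDual 𝕜 E) (n : ℕ),
      ‖c n * ψ (b n)‖ ≤ ‖c‖ * ‖ψ (b n)‖ := fun c ψ n => by
    rw [norm_mul]
    exact mul_le_mul_of_nonneg_right (c.norm_coe_le_norm n) (norm_nonneg _)
  have hs : ∀ (c : ℕ →ᵇ 𝕜) (ψ : StrongDual 𝕜 E), Summable fun n => c n * ψ (b n) := fun c ψ =>
    Summable.of_norm_bounded ((hsumm ψ).mul_left ‖c‖) (hle c ψ)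
  let L : (ℕ →ᵇ 𝕜) →ₗ[𝕜] StrongDual 𝕜 E →ₗ[𝕜] 𝕜 :=
    LinearMap.mk₂ 𝕜 (fun c ψ => ∑' n, c n * ψ (b n))
      (fun c d ψ => by
        rw [← (hs c ψ).tsum_add (hs d ψ)]
        exact tsum_congr fun n => by simp [add_mul])
      (fun a c ψ => by
        rw [smul_eq_mul, ← tsum_mul_left]
        exact tsum_congr fun n => by simp [mul_assoc])
      (fun c ψ χ => by
        rw [← (hs c ψ).tsum_add (hs c χ)]
        exact tsum_congr fun n => by simp [mul_add])
      (fun a c ψ => by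
        rw [smul_eq_mul, ← tsum_mul_left]
        exact tsum_congr fun n => by simp [mul_left_comm])
  refine ⟨L.mkContinuous₂ 1 fun c ψ => ?_, fun k => ?_⟩
  · rw [one_mul]
    refine (tsum_of_norm_bounded ((hsumm ψ).mul_left ‖c‖).hasSum (hle c ψ)).trans ?_
    rw [tsum_mul_left]
    exact mul_le_mul_of_nonneg_left ((hsumm ψ).tsum_le_of_sum_le (hbd ψ)) (norm_nonneg c)
  · ext ψ
    change ∑' n, boundedIndicator 𝕜 {k} n * ψ (b n) = ψ (b k)
    rw [tsum_eq_single k fun n hn => by simp [boundedIndicator_apply, hn]]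
    simp [boundedIndicator_apply]

end WeaklyUnconditionallyCauchy

/-! ### Operators on `c₀` -/

section CZero

variable {𝕜 : Type*} [RCLike 𝕜] {F : Type*} [NormedAddCommGroup F] [NormedSpace 𝕜 F]

namespace ZeroAtInftyContinuousMap

theorem norm_le_iff {x : C₀(ℕ, 𝕜)} {C : ℝ} (hC : 0 ≤ C) : ‖x‖ ≤ C ↔ ∀ n, ‖x n‖ ≤ C := by
  rw [← norm_toBCF_eq_norm, BoundedContinuousFunction.norm_le hC]
  rfl

theorem norm_apply_le (x : C₀(ℕ, 𝕜)) (n : ℕ) : ‖x n‖ ≤ ‖x‖ :=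
  (norm_le_iff (norm_nonneg x)).1 le_rfl n

/-- The coordinate functionals on `c₀`. -/
noncomputable def coordinate (𝕜 : Type*) [RCLike 𝕜] (n : ℕ) : StrongDual 𝕜 C₀(ℕ, 𝕜) :=
  LinearMap.mkContinuous
    { toFun := fun x => x n
      map_add' := fun _ _ => rfl
      map_smul' := fun _ _ => rfl } 1 fun x => by simpa using norm_apply_le x n

@[simp]
theorem coordinate_apply (n : ℕ) (x : C₀(ℕ, 𝕜)) : coordinate 𝕜 n x = x n := rfl

/-- The unit vectors of `c₀`. -/
noncomputable def unitVector (𝕜 : Type*) [RCLike 𝕜] (n : ℕ) : C₀(ℕ, 𝕜) where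
  toFun := Pi.single n 1
  continuous_toFun := continuous_of_discreteTopology
  zero_at_infty' := by
    rw [cocompact_eq_cofinite]
    refine tendsto_const_nhds.congr' ?_
    filter_upwards [(Set.finite_singleton n).compl_mem_cofinite] with m hm
    exact (Pi.single_eq_of_ne (M := fun _ => 𝕜) (by simpa using hm) 1).symm

theorem unitVector_apply (n m : ℕ) : unitVector 𝕜 n m = if m = n then 1 else 0 := by
  change (Pi.single n 1 : ℕ → 𝕜) m = _
  rw [Pi.single_apply]

/-- The coordinate projections on `c₀`. -/
noncomputable def coordinateProj (𝕜 : Type*) [RCLike 𝕜] (s : Finset ℕ) :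
    C₀(ℕ, 𝕜) →L[𝕜] C₀(ℕ, 𝕜) :=
  ∑ n ∈ s, (coordinate 𝕜 n).smulRight (unitVector 𝕜 n)

theorem coordinateProj_eq_sum (s : Finset ℕ) (x : C₀(ℕ, 𝕜)) :
    coordinateProj 𝕜 s x = ∑ n ∈ s, x n • unitVector 𝕜 n := by
  simp [coordinateProj]

theorem finsetSum_apply {ι : Type*} (s : Finset ι) (f : ι → C₀(ℕ, 𝕜)) (m : ℕ) :
    (∑ i ∈ s, f i) m = ∑ i ∈ s, f i m := by
  exact map_sum (coordinate 𝕜 m) f s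

theorem sum_smul_unitVector_apply (s : Finset ℕ) (c : ℕ → 𝕜) (m : ℕ) :
    (∑ n ∈ s, c n • unitVector 𝕜 n) m = if m ∈ s then c m else 0 := by
  simp [finsetSum_apply, unitVector_apply]

theorem coordinateProj_apply (s : Finset ℕ) (x : C₀(ℕ, 𝕜)) (m : ℕ) :
    coordinateProj 𝕜 s x m = if m ∈ s then x m else 0 := by
  rw [coordinateProj_eq_sum, sum_smul_unitVector_apply]

theorem tendsto_coordinateProj (x : C₀(ℕ, 𝕜)) :
    Tendsto (fun s => coordinateProj 𝕜 s x) atTop (𝓝 x) := by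
  rw [Metric.tendsto_atTop]
  intro ε hε
  have hx := x.zero_at_infty'
  rw [cocompact_eq_cofinite, Metric.tendsto_nhds] at hx
  have hfin := hx (ε / 2) (by positivity)
  rw [Filter.eventually_cofinite] at hfin
  refine ⟨hfin.toFinset, fun s hs => ?_⟩
  rw [dist_eq_norm]
  refine lt_of_le_of_lt ((norm_le_iff (by positivity : 0 ≤ ε / 2)).2 fun n => ?_) (half_lt_self hε)
  rw [sub_apply, coordinateProj_apply]
  by_cases hn : n ∈ s
  · simp only [hn, if_true, sub_self, norm_zero]
    positivity
  · have : n ∉ hfin.toFinset := fun h => hn (hs h)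
    simp only [Set.Finite.mem_toFinset, Set.mem_ofPred_eq, not_not, dist_zero_right] at this
    simpa [hn] using this.le

theorem norm_sum_smul_le_of_disjoint {b : ℕ → C₀(ℕ, 𝕜)} (hb : ∀ k, ‖b k‖ ≤ 1)
    (hdisj : ∀ k l, k ≠ l → ∀ n, b k n = 0 ∨ b l n = 0) (s : Finset ℕ) (c : ℕ → 𝕜)
    (hc : ∀ k, ‖c k‖ ≤ 1) : ‖∑ k ∈ s, c k • b k‖ ≤ 1 := by
  rw [norm_le_iff zero_le_one]
  intro n
  rw [finsetSum_apply]
  by_cases h : ∃ k ∈ s, b k n ≠ 0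
  · obtain ⟨k, hk, hkn⟩ := h
    rw [Finset.sum_eq_single_of_mem k hk fun l _ hl => by
      simp [(hdisj k l hl.symm n).resolve_left hkn], smul_apply, norm_smul]
    exact mul_le_one₀ (hc k) (norm_nonneg _) ((norm_apply_le _ n).trans (hb k))
  · push Not at h
    rw [Finset.sum_eq_zero fun k hk => by simp [h k hk]]
    simp

/-- If `T : c₀ → F` extends to the bidual of `c₀` and `F` is separable, then `T` is uniformly small
on finitely supported vectors of the unit ball which live far out. -/
theorem exists_finset_norm_apply_le [TopologicalSpace.SeparableSpace F] (T : C₀(ℕ, 𝕜) →L[𝕜] F)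
    (w : Bidual 𝕜 C₀(ℕ, 𝕜) →L[𝕜] F)
    (hw : ∀ x, w (NormedSpace.inclusionInDoubleDual 𝕜 _ x) = T x) {ε : ℝ} (hε : 0 < ε) :
    ∃ s : Finset ℕ, ∀ x : C₀(ℕ, 𝕜), (Function.support x).Finite → (∀ n ∈ s, x n = 0) →
      ‖x‖ ≤ 1 → ‖T x‖ ≤ ε := by
  classical
  by_contra! h
  let r : C₀(ℕ, 𝕜) → C₀(ℕ, 𝕜) → Prop := fun x y => ∀ n, x n = 0 ∨ y n = 0
  have : Std.Symm r := ⟨fun x y hxy n => (hxy n).symm⟩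
  obtain ⟨b, hb, hdisj⟩ := exists_seq_of_forall_finset_exists'
    (fun x : C₀(ℕ, 𝕜) => (Function.support x).Finite ∧ ‖x‖ ≤ 1 ∧ ε < ‖T x‖) r (by
      intro S hS
      have hfin : (⋃ x ∈ S, Function.support x).Finite :=
        S.finite_toSet.biUnion fun x hx => (hS x hx).1
      obtain ⟨y, hy, hy0, hy1, hyT⟩ := h hfin.toFinset
      refine ⟨y, ⟨hy, hy1, hyT⟩, fun x hx n => or_iff_not_imp_left.2 fun hxn => hy0 n ?_⟩
      rw [Set.Finite.mem_toFinset]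
      exact Set.mem_biUnion hx hxn)
  obtain ⟨J, hJ⟩ := exists_operator_bidual
    (norm_sum_smul_le_of_disjoint (fun k => (hb k).2.1) fun k l hkl => hdisj hkl)
  obtain ⟨k, hk⟩ := exists_norm_boundedIndicator_singleton_lt (w.comp J) hε
  rw [ContinuousLinearMap.comp_apply, hJ, hw] at hk
  exact (hb k).2.2.not_gt hk

/-- An operator from `c₀` to a separable space which extends to the bidual is the norm limit of its
compositions with the coordinate projections. -/
theorem tendsto_comp_coordinateProj [TopologicalSpace.SeparableSpace F] (T : C₀(ℕ, 𝕜) →L[𝕜] F)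
    (w : Bidual 𝕜 C₀(ℕ, 𝕜) →L[𝕜] F)
    (hw : ∀ x, w (NormedSpace.inclusionInDoubleDual 𝕜 _ x) = T x) :
    Tendsto (fun s => T.comp (coordinateProj 𝕜 s)) atTop (𝓝 T) := by
  rw [Metric.tendsto_atTop]
  intro ε hε
  obtain ⟨s₀, hs₀⟩ := exists_finset_norm_apply_le T w hw (half_pos hε)
  refine ⟨s₀, fun s hs => ?_⟩
  rw [dist_comm, dist_eq_norm]
  refine lt_of_le_of_lt (ContinuousLinearMap.opNorm_le_of_unit_norm (half_pos hε).le
    fun x hx => ?_) (half_lt_self hε)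
  set y := x - coordinateProj 𝕜 s x with hy
  have hyn : ∀ n, y n = if n ∈ s then 0 else x n := fun n => by
    rw [hy, sub_apply, coordinateProj_apply]
    split_ifs <;> simp
  change ‖T x - T (coordinateProj 𝕜 s x)‖ ≤ ε / 2
  rw [← map_sub]
  -- The tail `y` may have infinite support, so the estimate is applied to its truncations.
  refine le_of_tendsto ((T.continuous.tendsto y).comp (tendsto_coordinateProj y)).norm
    (Eventually.of_forall fun t => hs₀ _ ?_ ?_ ?_)
  · refine t.finite_toSet.subset fun n hn => ?_
    by_contra hnt
    exact hn (by rw [coordinateProj_apply]; exact if_neg hnt)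
  · intro n hn
    rw [coordinateProj_apply, hyn, if_pos (hs hn), ite_self]
  · rw [norm_le_iff zero_le_one]
    intro n
    have := (norm_apply_le x n).trans hx.le
    rw [coordinateProj_apply, hyn]
    split_ifs <;> simp [this]

theorem isCompactOperator_coordinateProj (s : Finset ℕ) :
    IsCompactOperator (coordinateProj 𝕜 s) := by
  change coordinateProj 𝕜 s ∈ compactOperator (RingHom.id 𝕜) C₀(ℕ, 𝕜) C₀(ℕ, 𝕜)
  exact Submodule.sum_mem _ fun n _ =>
    IsCompactOperator.clm_comp
      (isCompactOperator_of_locallyCompactSpace_dom (coordinate 𝕜 n))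
      (ContinuousLinearMap.toSpanSingleton 𝕜 (unitVector 𝕜 n))

end ZeroAtInftyContinuousMap

open ZeroAtInftyContinuousMap

theorem IsCompactOperator.isWeaklyCompactOperator {E : Type*} [NormedAddCommGroup E]
    [NormedSpace 𝕜 E] {T : E →L[𝕜] F} (hT : IsCompactOperator T) : IsWeaklyCompactOperator T := by
  obtain ⟨K, hK, hTK⟩ := hT.image_closedBall_subset_compact 1
  have hK' : IsCompact (toWeakSpace 𝕜 F '' K) := hK.image (toWeakSpaceCLM 𝕜 F).continuous
  exact hK'.of_isClosed_subset isClosed_closure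
    (closure_minimal (Set.image_mono hTK) hK'.isClosed)

/-- An operator from `c₀` to a separable space which extends to the bidual is weakly compact. -/
theorem isWeaklyCompactOperator_of_extends [CompleteSpace F] [TopologicalSpace.SeparableSpace F]
    (T : C₀(ℕ, 𝕜) →L[𝕜] F) (w : Bidual 𝕜 C₀(ℕ, 𝕜) →L[𝕜] F)
    (hw : ∀ x, w (NormedSpace.inclusionInDoubleDual 𝕜 _ x) = T x) : IsWeaklyCompactOperator T :=
  (isCompactOperator_of_tendsto (tendsto_comp_coordinateProj T w hw)
    (Eventually.of_forall fun s =>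
      (isCompactOperator_coordinateProj s).clm_comp T)).isWeaklyCompactOperator

/-- A functional extends to the bidual by evaluation, so `tendsto_comp_coordinateProj` with scalar
target makes its truncations converge in norm. -/
theorem tendsto_bidual_apply_sum (ξ : Bidual 𝕜 C₀(ℕ, 𝕜)) (ψ : StrongDual 𝕜 C₀(ℕ, 𝕜)) :
    Tendsto (fun s : Finset ℕ => ψ (∑ n ∈ s, ξ (coordinate 𝕜 n) • unitVector 𝕜 n)) atTop
      (𝓝 (ξ ψ)) := by
  have h := tendsto_comp_coordinateProj ψ
    (NormedSpace.inclusionInDoubleDual 𝕜 (StrongDual 𝕜 C₀(ℕ, 𝕜)) ψ) fun _ => rfl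
  refine ((ξ.continuous.tendsto ψ).comp h).congr fun s => ?_
  have hs : ψ.comp (coordinateProj 𝕜 s) = ∑ n ∈ s, ψ (unitVector 𝕜 n) • coordinate 𝕜 n := by
    ext x
    simp [coordinateProj_eq_sum, mul_comm]
  simp [hs, mul_comm]

theorem norm_sum_bidual_apply_smul_le (ξ : Bidual 𝕜 C₀(ℕ, 𝕜)) (s : Finset ℕ) :
    ‖∑ n ∈ s, ξ (coordinate 𝕜 n) • unitVector 𝕜 n‖ ≤ ‖ξ‖ := by
  rw [norm_le_iff (norm_nonneg ξ)]
  intro m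
  rw [sum_smul_unitVector_apply]
  split_ifs
  · exact (ξ.le_opNorm _).trans (mul_le_of_le_one_right (norm_nonneg ξ)
      (LinearMap.mkContinuous_norm_le _ zero_le_one _))
  · simp

/-- For a weakly compact operator `T` on `c₀`, the second adjoint of `T` maps into `F`. -/
theorem IsWeaklyCompactOperator.exists_bidual_apply_comp_eq {T : C₀(ℕ, 𝕜) →L[𝕜] F}
    (hT : IsWeaklyCompactOperator T) {ξ : Bidual 𝕜 C₀(ℕ, 𝕜)} (hξ : ‖ξ‖ ≤ 1) :
    ∃ y : F, ∀ f : StrongDual 𝕜 F, f y = ξ (f.comp T) := by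
  let y : Finset ℕ → F := fun s => T (∑ n ∈ s, ξ (coordinate 𝕜 n) • unitVector 𝕜 n)
  have hy : ∀ s, toWeakSpace 𝕜 F (y s) ∈
      closure (toWeakSpace 𝕜 F '' (T '' Metric.closedBall 0 1)) := fun s =>
    subset_closure ⟨_, ⟨_, mem_closedBall_zero_iff.2
      ((norm_sum_bidual_apply_smul_le ξ s).trans hξ), rfl⟩, rfl⟩
  -- Weak compactness gives the images of the truncations of `ξ` a weak limit along `U`.
  let U : Ultrafilter (Finset ℕ) := Ultrafilter.of atTop
  obtain ⟨z, -, hz⟩ := hT.ultrafilter_le_nhds (U.map fun s => toWeakSpace 𝕜 F (y s))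
    (le_principal_iff.2 (Filter.mem_map.2 (Filter.univ_mem' hy)))
  refine ⟨(toWeakSpace 𝕜 F).symm z, fun f => ?_⟩
  have hf : Continuous fun x : WeakSpace 𝕜 F => f ((toWeakSpace 𝕜 F).symm x) :=
    WeakBilin.eval_continuous (topDualPairing 𝕜 F).flip f
  have h1 : Tendsto (fun s => f (y s)) U (𝓝 (f ((toWeakSpace 𝕜 F).symm z))) :=
    (hf.tendsto z).comp hz
  exact tendsto_nhds_unique h1
    ((tendsto_bidual_apply_sum ξ (f.comp T)).mono_left (Ultrafilter.of_le _))

/-- A weakly compact operator on `c₀` extends to the bidual of `c₀`. -/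
theorem IsWeaklyCompactOperator.exists_extension {T : C₀(ℕ, 𝕜) →L[𝕜] F}
    (hT : IsWeaklyCompactOperator T) :
    ∃ w : Bidual 𝕜 C₀(ℕ, 𝕜) →L[𝕜] F,
      ∀ x, w (NormedSpace.inclusionInDoubleDual 𝕜 _ x) = T x := by
  let T₂ : Bidual 𝕜 C₀(ℕ, 𝕜) →L[𝕜] Bidual 𝕜 F :=
    ContinuousLinearMap.precomp 𝕜 (ContinuousLinearMap.precomp 𝕜 T)
  let φ := NormedSpace.inclusionInDoubleDualLi (E := F) 𝕜
  have hball : ∀ ξ, ‖ξ‖ ≤ 1 → T₂ ξ ∈ LinearMap.range φ.toLinearMap := fun ξ hξ => by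
    obtain ⟨y, hy⟩ := hT.exists_bidual_apply_comp_eq hξ
    exact ⟨y, ContinuousLinearMap.ext hy⟩
  have hrange : ∀ ξ, T₂ ξ ∈ LinearMap.range φ.toLinearMap := fun ξ => by
    by_cases h : ξ = 0
    · simp [h]
    have hc : ((‖ξ‖ : ℝ) : 𝕜) ≠ 0 := by simpa using h
    have := hball (((‖ξ‖ : ℝ) : 𝕜)⁻¹ • ξ) (by simp [norm_smul, h])
    rwa [map_smul, Submodule.smul_mem_iff _ (inv_ne_zero hc)] at this
  refine ⟨(φ.equivRange.symm.toContinuousLinearEquiv : _ →L[𝕜] F).comp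
    (T₂.codRestrict _ hrange), fun x => ?_⟩
  change φ.equivRange.symm _ = T x
  rw [LinearIsometryEquiv.symm_apply_eq]
  rfl

end CZero

/-! ### Homotopy as extension to the bidual -/

theorem hatI_sub_hatJ_apply {𝕜 E : Type*} [RCLike 𝕜] [NormedAddCommGroup E] [NormedSpace 𝕜 E]
    (x : E) : hatI 𝕜 E x - hatJ 𝕜 E x =
      toHat 𝕜 E (0, NormedSpace.inclusionInDoubleDual 𝕜 E x,
        -NormedSpace.inclusionInDoubleDual 𝕜 E x) := by
  simp [hatI, hatJ, ← map_sub]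

theorem proposition3 {𝕜 : Type*} [RCLike 𝕜] {F : Type*} [NormedAddCommGroup F]
    [NormedSpace 𝕜 F] [CompleteSpace F] [TopologicalSpace.SeparableSpace F]
    (u v : C₀(ℕ, 𝕜) →L[𝕜] F) :
    OperatorHomotopic u v ↔ IsWeaklyCompactOperator (u - v) := by
  constructor
  · rintro ⟨h, rfl, rfl⟩
    refine isWeaklyCompactOperator_of_extends _
      ((h.comp (toHat 𝕜 C₀(ℕ, 𝕜))).comp (ContinuousLinearMap.prod 0
        ((ContinuousLinearMap.id 𝕜 _).prod (-ContinuousLinearMap.id 𝕜 _)))) fun x => ?_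
    rw [sub_apply, ContinuousLinearMap.comp_apply (g := h),
      ContinuousLinearMap.comp_apply (g := h), ← map_sub, hatI_sub_hatJ_apply]
    rfl
  · intro hT
    obtain ⟨w, hw⟩ := hT.exists_extension
    refine ⟨v.comp (WithLp.fstL 2 𝕜 _ _) +
      w.comp ((WithLp.fstL 2 𝕜 _ _).comp (WithLp.sndL 2 𝕜 _ _)), ?_, ?_⟩
    · ext x
      change v x + w (NormedSpace.inclusionInDoubleDual 𝕜 _ x) = u x
      rw [hw, sub_apply, add_sub_cancel]
    · ext x
      change v x + w 0 = v x
      rw [map_zero, add_zero]
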